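/- Let $\mathbb{D}=\{z\in\mathbb{C}:|z|<1\}$ and $\mathbb{T}=\{z\in\mathbb{C}:|z|=1\}$. For $E\subset\mathbb{N}=\{0,1,2,\dots\}$ let $\underline{d}(E)=\liminf_{n\to\infty}\frac{|E\cap\{1,\dots,n\}|}{n}$ be its lower density. For a compact set $K\subset\mathbb{T}$ let $\mathcal{C}(K)$ be the space of continuous functions $K\to\mathbb{C}$ with the topology of uniform convergence. For a sequence $\varrho=(r_n)_n$ in $[0,1)$ tending to $1$, a holomorphic function $f$ on $\mathbb{D}$ is called $\varrho$-frequently Abel universal if for every compact set $K\subset\mathbb{T}$ with $K\neq\mathbb{T}$ and every non-empty open set $V\subset\mathcal{C}(K)$, the set $$\{n\in\mathbb{N}:\ (z\mapsto f(r_nz))|_K\in V\}$$ has positive lower density. Let $\mathcal{FU}_A(\mathbb{D},\varrho)$ be the set of all such functions. For each $l\in\mathbb{N}$ let $\varrho(l)=(r_n^l)_n$ be a strictly increasing sequence in $(0,1)$ with $r_n^l\to1$ as $n\to\infty$. Assume that for all $l\neq l'$, $\{r_n^l:n\in\mathbb{N}\}\cap\{r_n^{l'}:n\in\mathbb{N}\}=\emptyset$.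 Then $$\bigcap_{l\in\mathbb{N}}\mathcal{FU}_A(\mathbb{D},\varrho(l))\neq\emptyset.$$ -/

import Mathlib

open Filter Topology

namespace AbelUniversal

/-- The lower density `liminf_{n → ∞} |E ∩ {1, …, n}| / n` of a set `E` of natural numbers.
The quotients lie in `[0, 1]`, so the lower limit is a genuine one. -/
noncomputable def lowerDensity (E : Set ℕ) : ℝ :=
  liminf (fun n : ℕ => ((E ∩ Set.Icc 1 n).ncard : ℝ) / (n : ℝ)) atTop

/-- The set of all `n` such that the dilate `z ↦ f (r_n z)`, restricted to `K`, is an element of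
the set `V` of continuous functions on `K`. -/
def hittingSet (f : ℂ → ℂ) (r : ℕ → ℝ) (K : Set ℂ) (V : Set C(K, ℂ)) : Set ℕ :=
  {n | ∃ g ∈ V, ∀ z : K, g z = f ((r n : ℂ) * (z : ℂ))}

/-- The class of `r`-frequently Abel universal functions: `f` is holomorphic in the open unit disc
and, for every compact proper subset `K` of the unit circle and every non-empty open set `V` of
continuous functions on `K` (for the topology of uniform convergence, which on `C(K, ℂ)` with `K`
compact is the compact-open topology), the set of all `n` with `f (r_n ·)|_K ∈ V` has positive
lower density. -/
def FrequentlyAbelUniversal (f : ℂ → ℂ) (r : ℕ → ℝ) : Prop :=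
  DifferentiableOn ℂ f (Metric.ball (0 : ℂ) 1) ∧
    ∀ K : Set ℂ, IsCompact K → K ⊆ Metric.sphere (0 : ℂ) 1 → K ≠ Metric.sphere (0 : ℂ) 1 →
      ∀ V : Set C(K, ℂ), IsOpen V → V.Nonempty → 0 < lowerDensity (hittingSet f r K V)

end AbelUniversal

/-! Since the sequences are disjoint, each radius `r l n` can carry one task of its own. Keep only
the radii with `r l n > 1 - 1/(l+1)`: each sequence loses finitely many terms, and only finitely
many kept radii lie below any `t < 1`. All sequences thus merge into one increasing sequence tending
to 1.

The task at `(l, n)` is read off the 2-adic valuation of `n`, which codes a pair `(m, k)`: be close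
to `G k` on `A m`, where the `A m` are cofinal among the proper compact subsets of the circle and
the `G k` are dense. Indices of given valuation `p` have density `2^-(p+1)`, so each task recurs
with positive lower density in every sequence.

One function performs all tasks, with errors tending to 0 (`exists_differentiableOn_ball_near`): it
is a limit of polynomials, each correction being small on the disc already treated and prescribed on
an arc-like part of the next circle (`exists_polynomial_small_near`). Such corrections exist by a
Runge argument, because a disc and a proper closed subset of a larger circle do not separate the
plane. -/

/-! ### Runge approximation by spectral theory -/

/-- Runge's theorem for reciprocals of polynomials. -/
theorem exists_polynomial_near_inv {L : Set ℂ} (hL : IsCompact L) (hc : IsPreconnected Lᶜ)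
    (p : Polynomial ℂ) (hp : ∀ z ∈ L, p.eval z ≠ 0) {ε : ℝ} (hε : 0 < ε) :
    ∃ q : Polynomial ℂ, ∀ z ∈ L, ‖q.eval z - (p.eval z)⁻¹‖ < ε := by
  rcases L.eq_empty_or_nonempty with rfl | hne
  · exact ⟨0, by simp⟩
  have : CompactSpace L := isCompact_iff_compactSpace.mp hL
  have : Nonempty L := hne.to_subtype
  let S : Subalgebra ℂ C(L, ℂ) := (polynomialFunctions L).topologicalClosure
  have hS : IsClosed (S : Set C(L, ℂ)) := Subalgebra.isClosed_topologicalClosure _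
  have : CompleteSpace S := hS.completeSpace_coe
  have hmem (q : Polynomial ℂ) : q.toContinuousMapOn L ∈ S :=
    Subalgebra.le_topologicalClosure _ ⟨q, by simp, rfl⟩
  let x : S := ⟨Polynomial.X.toContinuousMapOn L, hmem _⟩
  have hx : spectrum ℂ (x : C(L, ℂ)) = L := by
    rw [ContinuousMap.spectrum_eq_range]
    ext z
    simp [x]
  -- Passing to a closed subalgebra can only fill holes of the spectrum, and `L` has none. So `p`
  -- evaluated at the coordinate function is already invertible in the closure of the polynomials.
  have hxS : spectrum ℂ x = L := by
    rw [Subalgebra.spectrum_eq_of_isPreconnected_compl S x (by rwa [hx]), hx]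
  have hunit : IsUnit (Polynomial.aeval x p) := by
    rw [← spectrum.zero_notMem_iff ℂ, spectrum.map_polynomial_aeval, hxS]
    rintro ⟨z, hz, h⟩
    exact hp z hz h
  obtain ⟨⟨g, hg⟩, hgp⟩ := hunit.exists_right_inv
  have hgz (z : L) : g z = (p.eval (z : ℂ))⁻¹ := by
    have h1 := congrArg (fun y : S => (y : C(L, ℂ)) z) hgp
    have h2 : ((Polynomial.aeval x p : S) : C(L, ℂ)) z = p.eval (z : ℂ) := by
      rw [← Subalgebra.coe_val, ← Polynomial.aeval_algHom_apply]
      simp [x, Polynomial.aeval_continuousMap_apply]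
    refine eq_inv_of_mul_eq_one_right ?_
    rw [← h2]
    simpa using h1
  have hg' : g ∈ closure (polynomialFunctions L : Set C(L, ℂ)) := hg
  obtain ⟨_, ⟨q, -, rfl⟩, hq⟩ := Metric.mem_closure_iff.mp hg' ε hε
  refine ⟨q, fun z hz => ?_⟩
  rw [← hgz ⟨z, hz⟩, ← dist_eq_norm, dist_comm]
  exact (ContinuousMap.dist_apply_le_dist _).trans_lt hq

/-! ### Connectedness of complements in the plane -/

theorem isPreconnected_annulus {a b : ℝ} (ha : 0 ≤ a) :
    IsPreconnected {z : ℂ | a < ‖z‖ ∧ ‖z‖ < b} := by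
  have h : {z : ℂ | a < ‖z‖ ∧ ‖z‖ < b} =
      (fun p : ℝ × ℝ => (p.1 : ℂ) * Complex.exp (p.2 * Complex.I)) '' (Set.Ioo a b ×ˢ Set.univ) := by
    ext z
    constructor
    · rintro ⟨h1, h2⟩
      exact ⟨(‖z‖, z.arg), ⟨⟨h1, h2⟩, trivial⟩, Complex.norm_mul_exp_arg_mul_I z⟩
    · rintro ⟨⟨t, θ⟩, ⟨⟨h1, h2⟩, -⟩, rfl⟩
      have h3 : |t| = t := abs_of_pos (ha.trans_lt h1)
      simp only [Set.mem_ofPred_eq, norm_mul, Complex.norm_real, Complex.norm_exp_ofReal_mul_I,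
        mul_one, Real.norm_eq_abs, h3]
      exact ⟨h1, h2⟩
  rw [h]
  exact (isPreconnected_Ioo.prod isPreconnected_univ).image _ (by fun_prop)

theorem isPreconnected_compl_closedBall_complex {a : ℝ} (ha : 0 ≤ a) :
    IsPreconnected {z : ℂ | a < ‖z‖} := by
  have h : {z : ℂ | a < ‖z‖} =
      (fun p : ℝ × ℝ => (p.1 : ℂ) * Complex.exp (p.2 * Complex.I)) '' (Set.Ioi a ×ˢ Set.univ) := by
    ext z
    constructor
    · intro h1
      exact ⟨(‖z‖, z.arg), ⟨h1, trivial⟩, Complex.norm_mul_exp_arg_mul_I z⟩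
    · rintro ⟨⟨t, θ⟩, ⟨h1, -⟩, rfl⟩
      have h3 : |t| = t := abs_of_pos (ha.trans_lt h1)
      simp only [Set.mem_ofPred_eq, norm_mul, Complex.norm_real, Complex.norm_exp_ofReal_mul_I,
        mul_one, Real.norm_eq_abs, h3]
      exact h1
  rw [h]
  exact (isPreconnected_Ioi.prod isPreconnected_univ).image _ (by fun_prop)

/-- The union of a closed disc and a proper closed subset of a larger circle does not separate
the plane. -/
theorem isPreconnected_compl_closedBall_union {s ρ : ℝ} (hs : 0 ≤ s) (hsρ : s < ρ) {M : Set ℂ}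
    (hM : IsClosed M) (hMρ : M ⊆ Metric.sphere 0 ρ) (hne : M ≠ Metric.sphere 0 ρ) :
    IsPreconnected (Metric.closedBall (0 : ℂ) s ∪ M)ᶜ := by
  have hρ : 0 < ρ := hs.trans_lt hsρ
  have hMn (z : ℂ) (hz : z ∈ M) : ‖z‖ = ρ := by simpa using hMρ hz
  set A := {z : ℂ | s < ‖z‖ ∧ ‖z‖ < ρ} with hA
  set B := {z : ℂ | ρ < ‖z‖} with hB
  set U := (Metric.closedBall (0 : ℂ) s ∪ M)ᶜ with hU
  have hUo : IsOpen U := (Metric.isClosed_closedBall.union hM).isOpen_compl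
  have hAU : A ⊆ U := by
    rintro z ⟨h1, h2⟩ (h | h)
    · simp at h; linarith
    · have := hMn z h; linarith
  have hBU : B ⊆ U := by
    rintro z h1 (h | h)
    · simp [hB] at h h1; linarith
    · have := hMn z h; simp [hB] at h1; linarith
  -- A small ball about a point of the circle off `M` bridges the inner annulus and the exterior.
  have key (a : ℂ) (ha : ‖a‖ = ρ) (haM : a ∉ M) :
      ∃ C ⊆ U, a ∈ C ∧ A ⊆ C ∧ B ⊆ C ∧ IsPreconnected C := by
    have haU : a ∈ U := by
      rintro (h | h)
      · simp at h; linarith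
      · exact haM h
    obtain ⟨δ, hδ, hball⟩ := Metric.isOpen_iff.mp hUo a haU
    have hpt (t : ℝ) (ht : 0 < 1 + t) (htδ : |t| * ρ < δ) :
        ((1 + t : ℝ) : ℂ) * a ∈ Metric.ball a δ ∧ ‖((1 + t : ℝ) : ℂ) * a‖ = (1 + t) * ρ := by
      constructor
      · rw [Metric.mem_ball, dist_eq_norm]
        have : ((1 + t : ℝ) : ℂ) * a - a = (t : ℂ) * a := by push_cast; ring
        rw [this, norm_mul, ha, Complex.norm_real, Real.norm_eq_abs]
        exact htδ
      · rw [norm_mul, ha, Complex.norm_real, Real.norm_eq_abs, abs_of_pos ht]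
    obtain ⟨t, ht0, ht⟩ : ∃ t : ℝ, 0 < t ∧ t < min (δ / ρ) (1 - s / ρ) :=
      exists_between (lt_min (by positivity) (by rw [sub_pos, div_lt_one hρ]; exact hsρ))
    have ht1 : t * ρ < δ := (lt_div_iff₀ hρ).mp (ht.trans_le (min_le_left _ _))
    have ht2 : s < (1 - t) * ρ := by
      have := ht.trans_le (min_le_right _ _)
      rw [← div_lt_iff₀ hρ]; linarith
    have ht3 : 0 < 1 - t := by
      by_contra h
      nlinarith
    have h1 := hpt t (by linarith) (by rwa [abs_of_pos ht0])
    have h2 := hpt (-t) (by linarith) (by rwa [abs_neg, abs_of_pos ht0])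
    refine ⟨A ∪ Metric.ball a δ ∪ B, Set.union_subset (Set.union_subset hAU hball) hBU,
      Or.inl (Or.inr (Metric.mem_ball_self hδ)), fun z hz => Or.inl (Or.inl hz),
      fun z hz => Or.inr hz, ?_⟩
    refine IsPreconnected.union' ⟨_, Or.inr h1.1, ?_⟩ (IsPreconnected.union' ⟨_, ?_, h2.1⟩
      (isPreconnected_annulus hs) (convex_ball a δ).isPreconnected)
      (isPreconnected_compl_closedBall_complex hρ.le)
    · change ρ < _
      rw [h1.2]; nlinarith
    · change s < _ ∧ _ < ρ
      rw [h2.2]; constructor <;> nlinarith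
  obtain ⟨ζ, hζ, hζM⟩ : ∃ ζ ∈ Metric.sphere (0 : ℂ) ρ, ζ ∉ M := by
    by_contra! h
    exact hne (hMρ.antisymm h)
  obtain ⟨b, hb⟩ : B.Nonempty := ⟨((ρ + 1 : ℝ) : ℂ), by
    change ρ < _
    rw [Complex.norm_real, Real.norm_eq_abs, abs_of_pos (by linarith)]; linarith⟩
  refine isPreconnected_of_forall b fun z hz => ?_
  rcases lt_trichotomy ‖z‖ ρ with h | h | h
  · obtain ⟨C, hCU, -, hAC, hBC, hC⟩ := key ζ (by simpa using hζ) hζM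
    have hsz : s < ‖z‖ := by
      by_contra! h'
      exact hz (Or.inl (by simpa using h'))
    exact ⟨C, hCU, hBC hb, hAC ⟨hsz, h⟩, hC⟩
  · obtain ⟨C, hCU, haC, -, hBC, hC⟩ := key z h (fun h' => hz (Or.inr h'))
    exact ⟨C, hCU, hBC hb, haC, hC⟩
  · exact ⟨B, hBU, hb, h, isPreconnected_compl_closedBall_complex hρ.le⟩

/-! ### Approximation on a disc and part of a larger circle -/

theorem eventually_pow_div_sub_lt {a b c : ℝ} (ha : 0 ≤ a) (hab : a < b) {ε : ℝ} (hε : 0 < ε) :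
    ∀ᶠ n : ℕ in atTop, c * (a ^ n / (b ^ n - a ^ n)) < ε := by
  have hb : 0 < b := ha.trans_lt hab
  have h1 : Tendsto (fun n : ℕ => (a / b) ^ n) atTop (𝓝 0) :=
    tendsto_pow_atTop_nhds_zero_of_lt_one (by positivity) ((div_lt_one hb).mpr hab)
  have h2 : Tendsto (fun n : ℕ => c * ((a / b) ^ n / (1 - (a / b) ^ n))) atTop (𝓝 0) := by
    simpa using (h1.div (tendsto_const_nhds.sub h1) (by norm_num : (1 : ℝ) - 0 ≠ 0)).const_mul c
  filter_upwards [h2.eventually_lt_const hε] with n hn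
  convert! hn using 2
  rw [div_pow, one_sub_div (by positivity), div_div_div_cancel_right₀ (by positivity)]

section
variable {s ρ : ℝ} {M : Set ℂ}

/-- Polynomials approximate the function that vanishes on a disc and equals `1 / z` on a proper
closed subset of a larger circle. -/
theorem exists_polynomial_near_zero_inv (hs : 0 < s) (hsρ : s < ρ)
    (hM : IsClosed M) (hMρ : M ⊆ Metric.sphere 0 ρ) (hne : M ≠ Metric.sphere 0 ρ)
    {ε : ℝ} (hε : 0 < ε) :
    ∃ q : Polynomial ℂ, (∀ z ∈ Metric.closedBall (0 : ℂ) s, ‖q.eval z‖ < ε) ∧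
      ∀ z ∈ M, ‖q.eval z - z⁻¹‖ < ε := by
  -- The model is `z^n / (z^(n+1) + σ^(n+1))`, which tends to 0 inside the circle of radius `σ` and
  -- to `1/z` outside. Its poles lie on that circle, off `L`, so Runge applies to the reciprocal of
  -- the denominator.
  obtain ⟨σ, hsσ, hσρ⟩ := exists_between hsρ
  have hσ : 0 < σ := hs.trans hsσ
  have hρ : 0 < ρ := hσ.trans hσρ
  have hMn (z : ℂ) (hz : z ∈ M) : ‖z‖ = ρ := by simpa using hMρ hz
  set L := Metric.closedBall (0 : ℂ) s ∪ M with hL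
  have hLc : IsCompact L := (isCompact_closedBall _ _).union
    ((isCompact_sphere (0 : ℂ) ρ).of_isClosed_subset hM hMρ)
  have hLn (z : ℂ) (hz : z ∈ L) : ‖z‖ ≤ ρ := by
    rcases hz with hz | hz
    · exact (by simpa using hz : ‖z‖ ≤ s).trans hsρ.le
    · exact (hMn z hz).le
  obtain ⟨n, h1, h2⟩ : ∃ n : ℕ, s⁻¹ * (s ^ (n + 1) / (σ ^ (n + 1) - s ^ (n + 1))) < ε / 2 ∧
      ρ⁻¹ * (σ ^ (n + 1) / (ρ ^ (n + 1) - σ ^ (n + 1))) < ε / 2 := by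
    have e1 := (eventually_pow_div_sub_lt (c := s⁻¹) hs.le hsσ (half_pos hε))
    have e2 := (eventually_pow_div_sub_lt (c := ρ⁻¹) hσ.le hσρ (half_pos hε))
    obtain ⟨n, hn⟩ := ((tendsto_add_atTop_nat 1).eventually (e1.and e2)).exists
    exact ⟨n, hn⟩
  have hσn : ‖((σ : ℂ)) ^ (n + 1)‖ = σ ^ (n + 1) := by
    rw [norm_pow, Complex.norm_real, Real.norm_eq_abs, abs_of_pos hσ]
  have hdisc (z : ℂ) (hz : ‖z‖ ≤ s) :
      0 < σ ^ (n + 1) - s ^ (n + 1) ∧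
        σ ^ (n + 1) - s ^ (n + 1) ≤ ‖z ^ (n + 1) + (σ : ℂ) ^ (n + 1)‖ := by
    refine ⟨sub_pos.mpr (pow_lt_pow_left₀ hsσ hs.le n.succ_ne_zero), ?_⟩
    have := norm_sub_le_norm_add ((σ : ℂ) ^ (n + 1)) (z ^ (n + 1))
    rw [hσn, norm_pow, add_comm ((σ : ℂ) ^ (n + 1))] at this
    have h3 : ‖z‖ ^ (n + 1) ≤ s ^ (n + 1) := by gcongr
    linarith
  have harc (z : ℂ) (hz : ‖z‖ = ρ) :
      0 < ρ ^ (n + 1) - σ ^ (n + 1) ∧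
        ρ ^ (n + 1) - σ ^ (n + 1) ≤ ‖z ^ (n + 1) + (σ : ℂ) ^ (n + 1)‖ := by
    refine ⟨sub_pos.mpr (pow_lt_pow_left₀ hσρ hσ.le n.succ_ne_zero), ?_⟩
    have := norm_sub_le_norm_add (z ^ (n + 1)) ((σ : ℂ) ^ (n + 1))
    rwa [hσn, norm_pow, hz] at this
  let p : Polynomial ℂ := Polynomial.X ^ (n + 1) + Polynomial.C ((σ : ℂ) ^ (n + 1))
  have hpz (z : ℂ) : p.eval z = z ^ (n + 1) + (σ : ℂ) ^ (n + 1) := by simp [p]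
  have hp (z : ℂ) (hz : z ∈ L) : p.eval z ≠ 0 := by
    rw [hpz, ← norm_pos_iff]
    rcases hz with hz | hz
    · have := hdisc z (by simpa using hz); linarith
    · have := harc z (hMn z hz); linarith
  obtain ⟨q, hq⟩ := exists_polynomial_near_inv hLc
    (isPreconnected_compl_closedBall_union hs.le hsρ hM hMρ hne) p hp
    (ε := ε / 2 / ρ ^ n) (by positivity)
  have hq' (z : ℂ) (hz : z ∈ L) : ‖z ^ n * q.eval z - z ^ n * (p.eval z)⁻¹‖ < ε / 2 := by
    rw [← mul_sub, norm_mul, norm_pow]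
    have h3 : ‖z‖ ^ n ≤ ρ ^ n := by gcongr; exact hLn z hz
    calc _ ≤ ρ ^ n * ‖q.eval z - (p.eval z)⁻¹‖ := by gcongr
      _ < ρ ^ n * (ε / 2 / ρ ^ n) := by gcongr; exact hq z hz
      _ = ε / 2 := by field_simp
  refine ⟨Polynomial.X ^ n * q, fun z hz => ?_, fun z hz => ?_⟩
  · have hzs : ‖z‖ ≤ s := by simpa using hz
    have hb : ‖z ^ n * (p.eval z)⁻¹‖ < ε / 2 := by
      refine lt_of_le_of_lt ?_ h1
      obtain ⟨h3, h4⟩ := hdisc z hzs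
      rw [norm_mul, norm_inv, norm_pow, hpz, pow_succ s n]
      calc ‖z‖ ^ n * ‖z ^ (n + 1) + (σ : ℂ) ^ (n + 1)‖⁻¹
          ≤ s ^ n * (σ ^ (n + 1) - s ^ (n + 1))⁻¹ := by gcongr
        _ = _ := by rw [pow_succ s n]; field_simp
    have := norm_le_norm_add_norm_sub' (z ^ n * q.eval z) (z ^ n * (p.eval z)⁻¹)
    have h5 := hq' z (Or.inl hz)
    simp only [Polynomial.eval_mul, Polynomial.eval_pow, Polynomial.eval_X]
    linarith
  · have hzρ := hMn z hz
    have hz0 : z ≠ 0 := norm_pos_iff.mp (hzρ ▸ hρ)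
    have hb : ‖z ^ n * (p.eval z)⁻¹ - z⁻¹‖ < ε / 2 := by
      refine lt_of_le_of_lt ?_ h2
      obtain ⟨h3, h4⟩ := harc z hzρ
      have h5 : z ^ n * (p.eval z)⁻¹ - z⁻¹ = -(z⁻¹ * ((σ : ℂ) ^ (n + 1) / p.eval z)) := by
        have := hp z (Or.inr hz)
        field_simp
        rw [hpz]; ring
      rw [h5, norm_neg, norm_mul, norm_inv, hzρ, norm_div, hσn, hpz]
      gcongr
    have h5 := hq' z (Or.inr hz)
    have := norm_sub_le_norm_sub_add_norm_sub (z ^ n * q.eval z) (z ^ n * (p.eval z)⁻¹) z⁻¹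
    simp only [Polynomial.eval_mul, Polynomial.eval_pow, Polynomial.eval_X]
    linarith

/-- Polynomials are uniformly dense in the continuous functions on a proper closed subset of a
circle. -/
theorem exists_polynomial_near_of_subset_sphere (hρ : 0 < ρ)
    (hM : IsClosed M) (hMρ : M ⊆ Metric.sphere 0 ρ) (hne : M ≠ Metric.sphere 0 ρ)
    (g : C(M, ℂ)) {ε : ℝ} (hε : 0 < ε) :
    ∃ q : Polynomial ℂ, ∀ z : M, ‖q.eval (z : ℂ) - g z‖ < ε := by
  have hMc : IsCompact M := (isCompact_sphere (0 : ℂ) ρ).of_isClosed_subset hM hMρ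
  have : CompactSpace M := isCompact_iff_compactSpace.mp hMc
  set S : Subalgebra ℂ C(M, ℂ) := (polynomialFunctions M).topologicalClosure with hS
  -- On the circle `conj z = ρ^2 / z`, so approximating `1/z` puts conjugation in the closure, and
  -- Stone–Weierstrass applies.
  have hstar : star (Polynomial.X.toContinuousMapOn M) ∈ S := by
    change _ ∈ closure (polynomialFunctions M : Set C(M, ℂ))
    refine Metric.mem_closure_iff.mpr fun δ hδ => ?_
    obtain ⟨q, -, hq⟩ := exists_polynomial_near_zero_inv (half_pos hρ) (half_lt_self hρ) hM hMρ hne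
      (ε := δ / 2 / ρ ^ 2) (by positivity)
    refine ⟨(Polynomial.C ((ρ : ℂ) ^ 2) * q).toContinuousMapOn M, ⟨_, by simp, rfl⟩, ?_⟩
    refine lt_of_le_of_lt ((ContinuousMap.dist_le (half_pos hδ).le).mpr fun z => ?_)
      (half_lt_self hδ)
    have hz : ‖(z : ℂ)‖ = ρ := by simpa using hMρ z.2
    have hz0 : (z : ℂ) ≠ 0 := norm_pos_iff.mp (hz ▸ hρ)
    have hconj : (starRingEnd ℂ) (z : ℂ) = (ρ : ℂ) ^ 2 * (z : ℂ)⁻¹ := by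
      rw [eq_mul_inv_iff_mul_eq₀ hz0, ← Complex.normSq_eq_conj_mul_self, Complex.normSq_eq_norm_sq, hz]
      push_cast; rfl
    rw [dist_comm, dist_eq_norm]
    have : ‖(ρ : ℂ) ^ 2 * (q.eval (z : ℂ) - (z : ℂ)⁻¹)‖ ≤ δ / 2 := by
      rw [norm_mul, norm_pow, Complex.norm_real, Real.norm_eq_abs, abs_of_pos hρ]
      calc _ ≤ ρ ^ 2 * (δ / 2 / ρ ^ 2) := by gcongr; exact (hq z z.2).le
        _ = δ / 2 := by field_simp
    simpa [hconj, mul_sub] using this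
  have htop : S = ⊤ := by
    have h1 : (polynomialFunctions M).starClosure.toSubalgebra ≤ S := by
      rw [Subalgebra.starClosure_toSubalgebra]
      refine sup_le (Subalgebra.le_topologicalClosure _) ?_
      rw [polynomialFunctions.eq_adjoin_X, Subalgebra.star_adjoin_comm, Algebra.adjoin_le_iff]
      intro f hf
      rw [Set.mem_star, Set.mem_singleton_iff] at hf
      rw [← star_star f, hf]
      exact hstar
    have h2 := polynomialFunctions.starClosure_topologicalClosure (𝕜 := ℂ) M
    rw [eq_top_iff]
    intro f _
    have h3 : f ∈ (polynomialFunctions M).starClosure.topologicalClosure := h2 ▸ trivial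
    have h4 : f ∈ closure ((polynomialFunctions M).starClosure : Set C(M, ℂ)) := h3
    exact closure_minimal (fun x hx => h1 hx) (Subalgebra.isClosed_topologicalClosure _) h4
  have hg : g ∈ closure (polynomialFunctions M : Set C(M, ℂ)) :=
    (htop ▸ trivial : g ∈ S)
  obtain ⟨_, ⟨q, -, rfl⟩, hq⟩ := Metric.mem_closure_iff.mp hg ε hε
  refine ⟨q, fun z => ?_⟩
  rw [← dist_eq_norm, dist_comm]
  exact (ContinuousMap.dist_apply_le_dist _).trans_lt hq

/-- If `u` is near 0 on the disc and near `1/z` on `M`, then `z * u` is nearly the indicator of `M`;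
it cuts off a polynomial `q` that approximates `g` on `M`. -/
theorem exists_polynomial_small_near (hs : 0 < s) (hsρ : s < ρ)
    (hM : IsClosed M) (hMρ : M ⊆ Metric.sphere 0 ρ) (hne : M ≠ Metric.sphere 0 ρ)
    {g : ℂ → ℂ} (hg : ContinuousOn g M) {ε : ℝ} (hε : 0 < ε) :
    ∃ q : Polynomial ℂ, (∀ z ∈ Metric.closedBall (0 : ℂ) s, ‖q.eval z‖ < ε) ∧
      ∀ z ∈ M, ‖q.eval z - g z‖ < ε := by
  have hρ : 0 < ρ := hs.trans hsρ
  obtain ⟨q, hq⟩ := exists_polynomial_near_of_subset_sphere hρ hM hMρ hne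
    ⟨M.domRestrict g, hg.domRestrict⟩ (half_pos hε)
  have hMn (z : ℂ) (hz : z ∈ M) : ‖z‖ = ρ := by simpa using hMρ hz
  obtain ⟨C, hC⟩ := (isCompact_closedBall (0 : ℂ) ρ).exists_bound_of_continuousOn
    q.continuous.continuousOn
  have hC0 : 0 ≤ C := (norm_nonneg _).trans (hC 0 (by simp [hρ.le]))
  obtain ⟨u, hu1, hu2⟩ := exists_polynomial_near_zero_inv hs hsρ hM hMρ hne
    (ε := ε / 2 / (ρ * (C + 1))) (by positivity)
  have hbound (z w : ℂ) (hz : ‖z‖ ≤ ρ) (hw : ‖w‖ < ε / 2 / (ρ * (C + 1))) :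
      ‖z * w * q.eval z‖ ≤ ε / 2 := by
    rw [norm_mul, norm_mul]
    have := hC z (by simpa using hz)
    calc _ ≤ ρ * (ε / 2 / (ρ * (C + 1))) * (C + 1) := by
          gcongr; linarith
      _ = ε / 2 := by field_simp
  refine ⟨Polynomial.X * u * q, fun z hz => ?_, fun z hz => ?_⟩
  · have hz' : ‖z‖ ≤ s := by simpa using hz
    have := hbound z (u.eval z) (hz'.trans hsρ.le) (hu1 z hz)
    simp only [Polynomial.eval_mul, Polynomial.eval_X]
    linarith
  · have hz0 : z ≠ 0 := norm_pos_iff.mp (hMn z hz ▸ hρ)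
    have h1 := hbound z (u.eval z - z⁻¹) (hMn z hz).le (hu2 z hz)
    have h2 : ‖q.eval z - g z‖ < ε / 2 := hq ⟨z, hz⟩
    have h3 : (Polynomial.X * u * q).eval z - g z =
        z * (u.eval z - z⁻¹) * q.eval z + (q.eval z - g z) := by
      simp only [Polynomial.eval_mul, Polynomial.eval_X]
      field_simp
      ring
    rw [h3]
    refine (norm_add_le _ _).trans_lt ?_
    linarith

end

/-! ### Merging the radii and building the function -/

/-- A countably infinite family of reals with finitely many members below each of its members can
be listed in increasing order. -/
theorem exists_strictMono_comp_of_finite_Iic {ι : Type*} [Infinite ι] {e : ι → ℝ}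
    (he : Function.Injective e) (hfin : ∀ i, {j | e j ≤ e i}.Finite) :
    ∃ φ : ℕ → ι, Function.Surjective φ ∧ StrictMono (e ∘ φ) := by
  -- The order pulled back along `e` is locally finite with a least and no greatest element, hence
  -- isomorphic to `ℕ`.
  let _ : LinearOrder ι := LinearOrder.lift' e he
  have hle {a b : ι} : a ≤ b ↔ e a ≤ e b := Iff.rfl
  let _ : LocallyFiniteOrder ι := LocallyFiniteOrder.ofFiniteIcc fun a b =>
    (hfin b).subset fun x hx => hx.2
  obtain ⟨i₀⟩ : Nonempty ι := inferInstance
  obtain ⟨m, -, hm⟩ := Set.exists_min_image _ e (hfin i₀) ⟨i₀, le_refl (e i₀)⟩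
  let _ : OrderBot ι :=
    { bot := m
      bot_le := fun a => by
        rcases le_total (e a) (e i₀) with h | h
        · exact hm a h
        · exact (hm i₀ (le_refl (e i₀))).trans h }
  have : NoMaxOrder ι := ⟨fun a => by
    obtain ⟨b, hb⟩ := (hfin a).exists_notMem
    exact ⟨b, not_le.mp hb⟩⟩
  let _ : SuccOrder ι := LinearLocallyFiniteOrder.succOrder ι
  let _ : PredOrder ι := LinearLocallyFiniteOrder.predOrder ι
  let E : ι ≃o ℕ := orderIsoNatOfLinearSuccPredArch
  have hlt {a b : ι} : a < b ↔ e a < e b := by rw [← not_le, ← not_le, hle]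
  exact ⟨E.symm, E.symm.surjective, fun a b hab => hlt.mp (E.symm.strictMono hab)⟩

/-- Simultaneous approximation, with errors tending to zero, of prescribed continuous functions on
proper closed subsets of circles whose radii increase to one. -/
theorem exists_differentiableOn_ball_near {ρ : ℕ → ℝ} (hρ0 : ∀ i, 0 < ρ i) (hmono : StrictMono ρ)
    (hlim : Tendsto ρ atTop (𝓝 1)) {K : ℕ → Set ℂ} (hK : ∀ i, IsClosed (K i))
    (hKs : ∀ i, K i ⊆ Metric.sphere 0 1) (hKne : ∀ i, K i ≠ Metric.sphere 0 1)
    {G : ℕ → ℂ → ℂ} (hG : ∀ i, Continuous (G i)) :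
    ∃ f : ℂ → ℂ, DifferentiableOn ℂ f (Metric.ball 0 1) ∧
      ∀ i, ∀ z ∈ K i, ‖f (ρ i * z) - G i z‖ ≤ 2 / 2 ^ i := by
  -- The disc of radius `s i` contains every circle treated before stage `i`; `ρ 0 / 2` is just a
  -- positive starting value.
  let s : ℕ → ℝ := fun i => Nat.casesOn i (ρ 0 / 2) ρ
  have hs0 (i : ℕ) : 0 < s i := by
    cases i with
    | zero => exact half_pos (hρ0 0)
    | succ i => exact hρ0 i
  have hsρ (i : ℕ) : s i < ρ i := by
    cases i with
    | zero => exact half_lt_self (hρ0 0)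
    | succ i => exact hmono i.lt_succ_self
  have step (i : ℕ) (P : Polynomial ℂ) : ∃ P' : Polynomial ℂ,
      (∀ z ∈ Metric.closedBall (0 : ℂ) (s i), ‖P'.eval z - P.eval z‖ < 1 / 2 / 2 ^ i) ∧
      ∀ z ∈ K i, ‖P'.eval (ρ i * z) - G i z‖ < 1 / 2 / 2 ^ i := by
    have hρi := hρ0 i
    have hc : (ρ i : ℂ) ≠ 0 := by exact_mod_cast hρi.ne'
    let M : Set ℂ := {w | w / ρ i ∈ K i}
    have hM : IsClosed M := (hK i).preimage (by fun_prop)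
    have hMs : M ⊆ Metric.sphere 0 (ρ i) := by
      intro w hw
      have := hKs i hw
      simpa [abs_of_pos hρi, div_eq_one_iff_eq hρi.ne'] using this
    have hMne : M ≠ Metric.sphere 0 (ρ i) := by
      intro h
      refine hKne i ((hKs i).antisymm fun z hz => ?_)
      have h1 : (ρ i : ℂ) * z ∈ M := by
        rw [h]
        have : ‖z‖ = 1 := by simpa using hz
        simp [this, abs_of_pos hρi]
      have h2 : (ρ i : ℂ) * z / ρ i ∈ K i := h1
      rwa [mul_div_cancel_left₀ z hc] at h2
    obtain ⟨q, hq1, hq2⟩ := exists_polynomial_small_near (hs0 i) (hsρ i) hM hMs hMne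
      (g := fun w => G i (w / ρ i) - P.eval w)
      (((hG i).comp (by fun_prop)).sub P.continuous).continuousOn
      (ε := 1 / 2 / 2 ^ i) (by positivity)
    refine ⟨P + q, fun z hz => by simpa using hq1 z hz, fun z hz => ?_⟩
    have hz' : (ρ i : ℂ) * z / ρ i = z := mul_div_cancel_left₀ z hc
    have := hq2 (ρ i * z) (by change _ / _ ∈ K i; rwa [hz'])
    rw [hz'] at this
    rw [Polynomial.eval_add]
    convert! this using 2
    ring
  choose Φ hΦ1 hΦ2 using step
  let F : ℕ → Polynomial ℂ := fun n => Nat.rec 0 Φ n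
  have hF (n : ℕ) : F (n + 1) = Φ n (F n) := rfl
  have hsmono (i j : ℕ) (h : i < j) : ρ i ≤ s j := by
    cases j with
    | zero => omega
    | succ j => exact hmono.monotone (by omega)
  have hdist (i : ℕ) (z : ℂ) (hz : ‖z‖ ≤ ρ i) (n : ℕ) :
      dist ((F (i + 1 + n)).eval z) ((F (i + 1 + (n + 1))).eval z) ≤
        1 / 2 ^ (i + 1) / 2 / 2 ^ n := by
    rw [dist_comm, dist_eq_norm, ← add_assoc, hF]
    refine (hΦ1 (i + 1 + n) (F (i + 1 + n)) z ?_).le.trans (le_of_eq ?_)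
    · simpa using hz.trans (hsmono i _ (by omega))
    · rw [pow_add]; field_simp
  -- Outside the unit disc the limit may fail to exist; the value there is irrelevant.
  let f : ℂ → ℂ := fun z => limUnder atTop fun n => (F n).eval z
  have hconv (i : ℕ) (z : ℂ) (hz : ‖z‖ ≤ ρ i) :
      Tendsto (fun n => (F (i + 1 + n)).eval z) atTop (𝓝 (f z)) := by
    obtain ⟨a, ha⟩ := cauchySeq_tendsto_of_complete
      (cauchySeq_of_le_geometric_two (hdist i z hz))
    have ha' : Tendsto (fun n => (F n).eval z) atTop (𝓝 a) := by
      rw [← tendsto_add_atTop_iff_nat (i + 1)]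
      simpa only [add_comm] using ha
    rw [show f z = a from ha'.limUnder_eq]
    exact ha
  have hbound (i : ℕ) (z : ℂ) (hz : ‖z‖ ≤ ρ i) (n : ℕ) :
      dist ((F (i + 1 + n)).eval z) (f z) ≤ 1 / 2 ^ (i + 1) / 2 ^ n :=
    dist_le_of_le_geometric_two_of_tendsto (hdist i z hz) (hconv i z hz) n
  refine ⟨f, ?_, fun i z hz => ?_⟩
  · have hloc : TendstoLocallyUniformlyOn (fun n z => (F n).eval z) f atTop (Metric.ball 0 1) := by
      rw [Metric.tendstoLocallyUniformlyOn_iff]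
      intro ε hε x hx
      obtain ⟨i, hi⟩ := (hlim.eventually_const_lt (by simpa using hx : ‖x‖ < 1)).exists
      refine ⟨Metric.ball 0 (ρ i), mem_nhdsWithin_of_mem_nhds
        (Metric.isOpen_ball.mem_nhds (by simpa using hi)), ?_⟩
      have h0 : Tendsto (fun n : ℕ => (1 : ℝ) / 2 ^ (i + 1) / 2 ^ n) atTop (𝓝 0) := by
        simpa [div_eq_mul_inv] using
          (tendsto_pow_atTop_nhds_zero_of_lt_one (by norm_num : (0 : ℝ) ≤ 2⁻¹)
            (by norm_num)).const_mul ((2 : ℝ) ^ (i + 1))⁻¹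
      obtain ⟨N, hN⟩ := eventually_atTop.mp (h0.eventually_lt_const hε)
      filter_upwards [eventually_ge_atTop (i + 1 + N)] with n hn z hz
      obtain ⟨k, rfl⟩ := Nat.exists_eq_add_of_le ((Nat.le_add_right _ _).trans hn)
      rw [dist_comm]
      exact (hbound i z (by simpa using (mem_ball_zero_iff.mp hz).le) k).trans_lt
        (hN k (by omega))
    exact hloc.differentiableOn (Eventually.of_forall fun n => (F n).differentiable.differentiableOn)
      Metric.isOpen_ball
  · have hz1 : ‖z‖ = 1 := by simpa using hKs i hz
    have h1 := hbound i (ρ i * z) (by simp [hz1, abs_of_pos (hρ0 i)]) 0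
    have h2 := hΦ2 i (F i) z hz
    rw [← hF] at h2
    rw [dist_comm, dist_eq_norm, add_zero, pow_zero, div_one] at h1
    have h3 := norm_sub_le_norm_sub_add_norm_sub (f (ρ i * z)) ((F (i + 1)).eval (ρ i * z)) (G i z)
    have h4 : (1 : ℝ) / 2 ^ (i + 1) = 1 / 2 / 2 ^ i := by rw [pow_succ]; field_simp
    have h5 : (1 : ℝ) / 2 / 2 ^ i + 1 / 2 / 2 ^ i ≤ 2 / 2 ^ i := by
      rw [← add_div]; gcongr; norm_num
    linarith

/-! ### Lower density and cofinal compact sets -/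

namespace AbelUniversal

/-- A set containing a tail of the arithmetic progression `2 ^ p * (2 * k + 1)` has positive lower
density. -/
theorem lowerDensity_pos_of_eventually {E : Set ℕ} (p : ℕ)
    (h : ∀ᶠ k in atTop, 2 ^ p * (2 * k + 1) ∈ E) : 0 < lowerDensity E := by
  obtain ⟨N, hN⟩ := eventually_atTop.mp h
  have hcard (n : ℕ) : n / 2 ^ (p + 1) - N ≤ (E ∩ Set.Icc 1 n).ncard := by
    have hinj : Function.Injective fun k : ℕ => 2 ^ p * (2 * k + 1) := fun a b hab => by
      have := Nat.eq_of_mul_eq_mul_left (by positivity) hab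
      omega
    have h1 : ((fun k : ℕ => 2 ^ p * (2 * k + 1)) '' Set.Ico N (n / 2 ^ (p + 1))).ncard =
        n / 2 ^ (p + 1) - N := by
      rw [Set.ncard_image_of_injective _ hinj, ← Finset.coe_Ico, Set.ncard_coe_finset, Nat.card_Ico]
    rw [← h1]
    refine Set.ncard_le_ncard ?_ ((Set.finite_Icc 1 n).inter_of_right _)
    rintro _ ⟨k, ⟨hk1, hk2⟩, rfl⟩
    refine ⟨hN k hk1, Nat.mul_pos (by positivity) (by omega), ?_⟩
    calc 2 ^ p * (2 * k + 1) ≤ 2 ^ p * (2 * (k + 1)) := by gcongr; omega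
      _ = (k + 1) * 2 ^ (p + 1) := by ring
      _ ≤ n / 2 ^ (p + 1) * 2 ^ (p + 1) := by gcongr; omega
      _ ≤ n := Nat.div_mul_le_self _ _
  have hle (n : ℕ) : ((E ∩ Set.Icc 1 n).ncard : ℝ) / n ≤ 1 := by
    refine div_le_one_of_le₀ ?_ n.cast_nonneg
    have := Set.ncard_le_ncard (Set.inter_subset_right : E ∩ Set.Icc 1 n ⊆ Set.Icc 1 n)
      (Set.finite_Icc 1 n)
    rw [← Finset.coe_Icc, Set.ncard_coe_finset, Nat.card_Icc] at this
    exact_mod_cast this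
  -- Half the true density `1 / 2^(p+1)`, leaving room for the `N` discarded terms and the rounding.
  have hpos : (0 : ℝ) < 1 / 2 ^ (p + 2) := by positivity
  refine hpos.trans_le (le_liminf_of_le ?_ ?_)
  · exact (isBoundedUnder_of ⟨1, hle⟩ : IsBoundedUnder (· ≤ ·) atTop _).isCoboundedUnder_ge
  · filter_upwards [eventually_ge_atTop (2 ^ (p + 2) * (N + 1))] with n hn
    have hn0 : 0 < n := lt_of_lt_of_le (by positivity) hn
    rw [div_le_div_iff₀ (by positivity) (by positivity), one_mul]
    have h1 : n < (n / 2 ^ (p + 1) + 1) * 2 ^ (p + 1) := by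
      have := Nat.lt_div_mul_add (a := n) (b := 2 ^ (p + 1)) (by positivity)
      linarith
    have h2 : n / 2 ^ (p + 1) ≤ (E ∩ Set.Icc 1 n).ncard + N := by
      have := hcard n; omega
    have h3 : n ≤ (E ∩ Set.Icc 1 n).ncard * 2 ^ (p + 2) := by
      have h4 : (2 : ℕ) ^ (p + 2) = 2 * 2 ^ (p + 1) := by ring
      rw [h4] at hn ⊢
      have h5 : 0 < 2 ^ (p + 1) := by positivity
      generalize 2 ^ (p + 1) = D at *
      generalize n / D = q at *
      nlinarith
    exact_mod_cast h3

/-- A countable family of proper closed subsets of the circle that is cofinal among the proper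
compact subsets. -/
theorem exists_seq_cofinal_proper_compacts : ∃ A : ℕ → Set ℂ,
    (∀ m, IsClosed (A m) ∧ A m ⊆ Metric.sphere 0 1 ∧ A m ≠ Metric.sphere 0 1) ∧
    ∀ K : Set ℂ, IsCompact K → K ⊆ Metric.sphere 0 1 → K ≠ Metric.sphere 0 1 → ∃ m, K ⊆ A m := by
  have : Nonempty (Metric.sphere (0 : ℂ) 1) := ⟨1, by simp⟩
  let x : ℕ → Metric.sphere (0 : ℂ) 1 := TopologicalSpace.denseSeq _
  refine ⟨fun m => Metric.sphere 0 1 \ Metric.ball (x m.unpair.1 : ℂ) (1 / (m.unpair.2 + 1)),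
    fun m => ⟨?_, Set.sdiff_subset, fun h => ?_⟩, fun K hK hKs hKne => ?_⟩
  · exact Metric.isClosed_sphere.sdiff Metric.isOpen_ball
  · have h1 := (x m.unpair.1).2
    exact (h.ge h1).2 (Metric.mem_ball_self (by positivity))
  · obtain ⟨ζ, hζ, hζK⟩ : ∃ ζ ∈ Metric.sphere (0 : ℂ) 1, ζ ∉ K := by
      by_contra! h
      exact hKne (hKs.antisymm h)
    obtain ⟨ε, hε, hball⟩ := Metric.isOpen_iff.mp hK.isClosed.isOpen_compl ζ hζK
    obtain ⟨j, hj⟩ := (TopologicalSpace.denseRange_denseSeq (Metric.sphere (0 : ℂ) 1)).exists_dist_lt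
      ⟨ζ, hζ⟩ (half_pos hε)
    obtain ⟨q, hq⟩ := exists_nat_one_div_lt (half_pos hε)
    refine ⟨Nat.pair j q, fun z hz => ⟨hKs hz, fun hzb => hball ?_ hz⟩⟩
    simp only [Nat.unpair_pair] at hzb
    have h1 : dist ζ (x j : ℂ) < ε / 2 := hj
    rw [Metric.mem_ball] at hzb ⊢
    have := dist_triangle_right z ζ (x j : ℂ)
    linarith

end AbelUniversal

/-! ### Distribution of the tasks -/

theorem proposition6p9 (r : ℕ → ℕ → ℝ)
    (hr_mem : ∀ l n, r l n ∈ Set.Ioo (0 : ℝ) 1)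
    (hr_mono : ∀ l, StrictMono (r l))
    (hr_lim : ∀ l, Tendsto (r l) atTop (𝓝 1))
    (hr_disj : ∀ l l', l ≠ l' → Set.range (r l) ∩ Set.range (r l') = ∅) :
    ∃ f : ℂ → ℂ, ∀ l, AbelUniversal.FrequentlyAbelUniversal f (r l) := by
  obtain ⟨A, hA, hAcof⟩ := AbelUniversal.exists_seq_cofinal_proper_compacts
  -- Targets live on all of `ℂ`, so one sequence serves every `K`; Tietze extension makes the
  -- restrictions dense.
  let G : ℕ → C(ℂ, ℂ) := TopologicalSpace.denseSeq _
  let I : Type := {p : ℕ × ℕ // 1 - 1 / ((p.1 : ℝ) + 1) < r p.1 p.2}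
  let e : I → ℝ := fun p => r p.1.1 p.1.2
  have he : Function.Injective e := by
    rintro ⟨⟨l, n⟩, hp⟩ ⟨⟨l', n'⟩, hp'⟩ (h : r l n = r l' n')
    obtain rfl : l = l' := by
      by_contra hl
      have : r l n ∈ Set.range (r l) ∩ Set.range (r l') := ⟨⟨n, rfl⟩, ⟨n', h.symm⟩⟩
      rw [hr_disj l l' hl] at this
      exact this
    obtain rfl : n = n' := (hr_mono l).injective h
    rfl
  have hfin (t : ℝ) (ht : t < 1) : {j | e j ≤ t}.Finite := by
    obtain ⟨m, hm⟩ := exists_nat_one_div_lt (sub_pos.mpr ht)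
    have hsub : {j | e j ≤ t} ⊆
        Subtype.val ⁻¹' (⋃ l ∈ Set.Iio m, Prod.mk l '' {n | r l n ≤ t}) := by
      rintro ⟨⟨l, n⟩, hp⟩ (hj : r l n ≤ t)
      have hl : l < m := by
        by_contra! hl
        have h1 : (1 : ℝ) / (l + 1) ≤ 1 / (m + 1) := by gcongr
        simp only at hp
        linarith
      simp only [Set.mem_preimage, Set.mem_iUnion]
      exact ⟨l, hl, n, hj, rfl⟩
    refine (Set.Finite.preimage Subtype.val_injective.injOn ?_).subset hsub
    refine (Set.finite_Iio m).biUnion fun l _ => Set.Finite.image _ ?_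
    have h1 := (hr_lim l).eventually_const_lt ht
    rw [← Nat.cofinite_eq_atTop] at h1
    refine (eventually_cofinite.mp h1).subset fun n hn => ?_
    exact not_lt.mpr hn
  have htail (l : ℕ) : ∀ᶠ n in atTop, 1 - 1 / ((l : ℝ) + 1) < r l n :=
    (hr_lim l).eventually_const_lt (sub_lt_self _ (by positivity))
  have : Infinite I := by
    obtain ⟨N, hN⟩ := eventually_atTop.mp (htail 0)
    refine Infinite.of_injective (fun k : ℕ => (⟨(0, N + k), hN _ (by omega)⟩ : I)) fun a b hab => ?_
    have := congrArg (fun i : I => i.1.2) hab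
    simpa using this
  obtain ⟨φ, hφs, hφm⟩ := exists_strictMono_comp_of_finite_Iic he
    fun i => hfin _ (hr_mem _ _).2
  let τ : ℕ → ℕ × ℕ := fun i => Nat.unpair (padicValNat 2 (φ i).1.2)
  have hlim : Tendsto (e ∘ φ) atTop (𝓝 1) := by
    refine tendsto_order.mpr ⟨fun t ht => ?_, fun t ht =>
      Eventually.of_forall fun i => (hr_mem _ _).2.trans ht⟩
    rw [← Nat.cofinite_eq_atTop]
    refine eventually_cofinite.mpr (((hfin t ht).preimage
      (hφm.injective.of_comp).injOn).subset fun i hi => ?_)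
    exact not_lt.mp hi
  obtain ⟨f, hf, hfG⟩ := exists_differentiableOn_ball_near (fun i => (hr_mem _ _).1) hφm hlim
    (fun i => (hA (τ i).1).1) (fun i => (hA (τ i).1).2.1) (fun i => (hA (τ i).1).2.2)
    (fun i => (G (τ i).2).continuous)
  refine ⟨f, fun l => ⟨hf, fun K hK hKs hKne V hV hVne => ?_⟩⟩
  obtain ⟨m, hm⟩ := hAcof K hK hKs hKne
  have : CompactSpace K := isCompact_iff_compactSpace.mp hK
  obtain ⟨k, hk⟩ : ∃ k, (G k).restrict K ∈ V := by
    obtain ⟨g, hg⟩ := hVne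
    obtain ⟨g', hg'⟩ := ContinuousMap.exists_restrict_eq hK.isClosed g
    have hop : IsOpen ((fun h : C(ℂ, ℂ) => h.restrict K) ⁻¹' V) :=
      hV.preimage (ContinuousMap.continuous_restrict K)
    exact (TopologicalSpace.denseRange_denseSeq C(ℂ, ℂ)).exists_mem_open hop
      ⟨g', by simpa [hg'] using hg⟩
  obtain ⟨ε, hε, hball⟩ := Metric.isOpen_iff.mp hV _ hk
  have hsmall : ∀ᶠ i : ℕ in atTop, (2 : ℝ) / 2 ^ i < ε := by
    have h0 : Tendsto (fun n : ℕ => (2 : ℝ) / 2 ^ n) atTop (𝓝 0) := by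
      simpa [div_eq_mul_inv] using
        (tendsto_pow_atTop_nhds_zero_of_lt_one (by norm_num : (0 : ℝ) ≤ 2⁻¹)
          (by norm_num)).const_mul (2 : ℝ)
    exact h0.eventually_lt_const hε
  obtain ⟨i₀, hi₀⟩ := eventually_atTop.mp hsmall
  have hgood : ∀ᶠ n in atTop, padicValNat 2 n = Nat.pair m k →
      n ∈ AbelUniversal.hittingSet f (r l) K V := by
    -- Once `r l n` exceeds the radius of index `i₀`, its own index is beyond `i₀`, where the error
    -- is below `ε`.
    filter_upwards [htail l, (hr_lim l).eventually_const_lt (hr_mem _ _ : e (φ i₀) ∈ _).2]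
      with n hn1 hn2 hn
    obtain ⟨i, hi⟩ := hφs ⟨(l, n), hn1⟩
    have hei : (e ∘ φ) i = r l n := by simp [e, hi]
    have hii : i₀ < i := hφm.lt_iff_lt.mp (by rw [hei]; exact hn2)
    have hτ : τ i = (m, k) := by simp [τ, hi, hn]
    have happ (z : ℂ) (hz : z ∈ K) : ‖f (r l n * z) - G k z‖ ≤ 2 / 2 ^ i := by
      have := hfG i z (by rw [hτ]; exact hm hz)
      rwa [hi, hτ] at this
    have hcont : Continuous fun z : K => f ((r l n : ℂ) * (z : ℂ)) := by
      refine hf.continuousOn.comp_continuous (by fun_prop) fun z => ?_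
      have hz : ‖(z : ℂ)‖ = 1 := by simpa using hKs z.2
      simp [hz, abs_of_pos (hr_mem l n).1, (hr_mem l n).2]
    refine ⟨⟨_, hcont⟩, hball ?_, fun z => rfl⟩
    rw [Metric.mem_ball]
    refine lt_of_le_of_lt ((ContinuousMap.dist_le (by positivity)).mpr fun z => ?_) (hi₀ i hii.le)
    rw [dist_eq_norm]
    exact happ z z.2
  refine AbelUniversal.lowerDensity_pos_of_eventually (Nat.pair m k) ?_
  have htend : Tendsto (fun j : ℕ => 2 ^ Nat.pair m k * (2 * j + 1)) atTop atTop := by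
    refine tendsto_atTop_mono (fun j => ?_) tendsto_id
    have : 1 ≤ 2 ^ Nat.pair m k := Nat.one_le_two_pow
    simp only [id]
    nlinarith
  filter_upwards [htend.eventually hgood] with j hj
  refine hj ?_
  rw [padicValNat.mul (by positivity) (by omega), padicValNat.prime_pow,
    padicValNat.eq_zero_of_not_dvd (by omega), add_zero]
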